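/- Let $m\ge 1$ and let $A=[a_{ij}]\in\mathbb{R}^{m\times m}$ have nonnegative entries. For a real square matrix $C$ let $\rho(C)$ be its spectral radius, i.e. the maximum of the absolute values of its complex eigenvalues. For a nonzero vector $\mathbf{x}\ge\mathbf{0}$ in $\mathbb{R}^m$ put $$r(A,I,\mathbf{x})=\inf\{t\ge 0:\ A\mathbf{x}\le t\,\mathbf{x}\}\in[0,\infty]$$ (with $\inf\emptyset=\infty$), and let $$\rho(A,I)=\inf_{\mathbf{x}>\mathbf{0}} r(A,I,\mathbf{x}),\qquad \hat\rho(A,I)=\inf_{\mathbf{x}\ge\mathbf{0},\ \mathbf{x}\ne\mathbf{0}} r(A,I,\mathbf{x}),$$ where vector inequalities are meant coordinatewise. Let $\vec G(A)$ be the digraph on $\{1,\dots,m\}$ with a diedge $(i,j)$ if and only if $a_{ij}>0$. A digraph is strongly connected if for any two distinct vertices $v,w$ it contains a dipath from $v$ to $w$ (so a digraph with one vertex is strongly connected), and $A$ is irreducible if $\vec G(A)$ is strongly connected. Let $V_1,\dots,V_k$ be the vertex sets of the strongly connected components of $\vec G(A)$, i.e. the maximal nonempty vertex sets inducing strongly connected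 subdigraphs. The reduced digraph $\vec G_{red}$ has vertices $V_1,\dots,V_k$ and a diedge $(V_i,V_j)$ whenever $i\ne j$ and $\vec G(A)$ has a diedge from a vertex of $V_i$ to a vertex of $V_j$. A source of $\vec G_{red}$ is a vertex that no diedge enters, and a sink is a vertex that no diedge leaves. $A[V_i]$ denotes the principal submatrix of $A$ with rows and columns in $V_i$. Then: 1. $\rho(A,I)=\rho(A)$, and $A\mathbf{y}=\rho(A)\mathbf{y}$ for some nonzero $\mathbf{y}\ge\mathbf{0}$. 2. There exists $\mathbf{x}=(x_1,\dots,x_m)^\top>\mathbf{0}$ such that $\rho(A)=\max_{1\le i\le m}\frac{(A\mathbf{x})_i}{x_i}$ if and only if every $V_j$ with $\rho(A[V_j])=\rho(A)$ is a sink of $\vec G_{red}$. 3. If $A$ is irreducible, then there is exactly one vector $\mathbf{x}>\mathbf{0}$ with $\sum_{i=1}^m x_i=1$ and $\rho(A)=\max_{1\le i\le m}\frac{(A\mathbf{x})_i}{x_i}$. 4. $\hat\rho(A,I)=\min\{\rho(A[V_i]) : V_i \text{ is a source of } \vec G_{red}\}$, and there is a nonzero $\mathbf{w}\ge\mathbf{0}$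 with $A\mathbf{w}=\hat\rho(A,I)\,\mathbf{w}$ and $r(A,I,\mathbf{w})=\hat\rho(A,I)$. -/

import Mathlib

open scoped NNReal ENNReal Matrix

namespace CollatzWielandt

noncomputable section

/-! Digraphs: strong connectivity, strongly connected components, the reduced digraph. -/

/-- The subdigraph of `G` induced by the set `W` of vertices. -/
def inducedSubdigraph {V : Type*} (G : Digraph V) (W : Finset V) : Digraph W :=
  ⟨fun v w => G.Adj v w⟩

/-- A digraph is strongly connected if for any two distinct vertices `v`, `w` there is a dipath
(of at least one diedge) from `v` to `w`. A digraph with one vertex is strongly connected. -/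
def StronglyConnected {V : Type*} (G : Digraph V) : Prop :=
  ∀ v w : V, v ≠ w → Relation.TransGen G.Adj v w

/-- The vertex sets of the strongly connected components of `G`: the maximal nonempty sets of
vertices that induce a strongly connected subdigraph. If `G` is strongly connected (and nonempty),
the only one is the set of all vertices. -/
def IsStrongComponent {V : Type*} (G : Digraph V) (W : Finset V) : Prop :=
  Maximal (fun U : Finset V => U.Nonempty ∧ StronglyConnected (inducedSubdigraph G U)) W

/-- The vertices `V₁, …, V_k` of the reduced digraph: the strongly connected components. -/
abbrev StrongComponent {V : Type*} (G : Digraph V) : Type _ :=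
  {W : Finset V // IsStrongComponent G W}

/-- The reduced digraph: there is a diedge from `P` to `Q` if `P ≠ Q` and `G` has a diedge
from a vertex in `P` to a vertex in `Q`. -/
def reducedDigraph {V : Type*} (G : Digraph V) : Digraph (StrongComponent G) :=
  ⟨fun P Q => P ≠ Q ∧ ∃ v ∈ P.1, ∃ w ∈ Q.1, G.Adj v w⟩

/-- A source: a vertex that no diedge enters. -/
def IsSource {V : Type*} (G : Digraph V) (p : V) : Prop :=
  ∀ q, ¬ G.Adj q p

/-- A sink: a vertex that no diedge leaves. -/
def IsSink {V : Type*} (G : Digraph V) (p : V) : Prop :=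
  ∀ q, ¬ G.Adj p q

/-! Matrices. -/

/-- The digraph of a nonnegative matrix: `(i, j)` is a diedge if and only if `a i j > 0`. -/
def matrixDigraph {ι : Type*} (A : Matrix ι ι ℝ) : Digraph ι :=
  ⟨fun i j => 0 < A i j⟩

/-- A nonnegative matrix is irreducible if its digraph is strongly connected
(so every matrix of size one is irreducible, also the zero matrix of size one). -/
def Irreducible {ι : Type*} (A : Matrix ι ι ℝ) : Prop :=
  StronglyConnected (matrixDigraph A)

/-- The principal submatrix `A[U]`. -/
def principalSubmatrix {ι : Type*} (A : Matrix ι ι ℝ) (U : Finset ι) : Matrix U U ℝ :=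
  A.submatrix (fun i : U => (i : ι)) (fun i : U => (i : ι))

/-- The spectral radius of a real square matrix: the maximum of the absolute values of its complex
eigenvalues, a real number since the spectrum is finite. -/
def specRadius {ι : Type*} [Fintype ι] [DecidableEq ι] (A : Matrix ι ι ℝ) : ℝ :=
  (spectralRadius ℂ (A.map (algebraMap ℝ ℂ))).toReal

/-! The Collatz-Wielandt quotients of a pair of matrices. -/

/-- `r(A, B, x) = inf {t ≥ 0 : A x ≤ t B x}` in `[0, ∞]`, the infimum of the empty set being `∞`. -/
def cwRatio {m n : Type*} [Fintype n] (A B : Matrix m n ℝ) (x : n → ℝ) : ℝ≥0∞ :=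
  ⨅ (t : ℝ≥0) (_ : ∀ i, (A *ᵥ x) i ≤ (t : ℝ) * (B *ᵥ x) i), (t : ℝ≥0∞)

/-- The Collatz-Wielandt quotient `ρ(A, B)`: the infimum of `r(A, B, x)` over positive `x`. -/
def cwQuotient {m n : Type*} [Fintype n] (A B : Matrix m n ℝ) : ℝ≥0∞ :=
  ⨅ (x : n → ℝ) (_ : ∀ i, 0 < x i), cwRatio A B x

/-- The weak Collatz-Wielandt quotient `ρ̂(A, B)`: the infimum of `r(A, B, x)` over nonzero
nonnegative `x`. -/
def weakCWQuotient {m n : Type*} [Fintype n] (A B : Matrix m n ℝ) : ℝ≥0∞ :=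
  ⨅ (x : n → ℝ) (_ : (∀ i, 0 ≤ x i) ∧ x ≠ 0), cwRatio A B x

end

end CollatzWielandt

namespace CollatzWielandt

/-! ### Perron–Frobenius theory and Collatz–Wielandt bounds. -/

section PerronFrobenius

variable {ι : Type*} [Fintype ι]

/-! If `x > 0` and `A x ≤ t x`, every complex eigenvalue has modulus at most `t`
(`norm_le_of_mulVec_le`). Conversely, perturbing to positive matrices and passing to a limit yields
an eigenvalue `r` with a nonnegative eigenvector, such that every `t > r` is a Collatz–Wielandt
bound (`exists_nonneg_eigenvector`). Hence `r` is the spectral radius, which gives part 1.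

For irreducible `A`, nonzero nonnegative vectors with `A y ≤ s y` are positive
(`pos_of_irreducible`). Subtracting the largest possible multiple of the Perron vector then gives
uniqueness, part 3.

In part 2, irreducibility makes every row of a component of maximal spectral radius saturated, so no
diedge can leave it. Conversely, if these components are sinks, their Perron vectors do not see the
other coordinates; the remaining block has strictly smaller spectral radius, and scaling its test
vector up absorbs the coupling.

In part 4, the support of a nonnegative `x` with `A x ≤ t x` is closed under predecessors, so it
contains a source component; the Perron vector of a source, extended by zero, is an eigenvector of
`A`. -/

theorem mulVec_apply_pos {A : Matrix ι ι ℝ} (hA : ∀ i j, 0 < A i j) {x : ι → ℝ}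
    (hx : ∀ i, 0 ≤ x i) (hx0 : x ≠ 0) (i : ι) : 0 < (A *ᵥ x) i := by
  obtain ⟨j, hj⟩ := Function.ne_iff.1 hx0
  exact Finset.sum_pos' (fun k _ => mul_nonneg (hA i k).le (hx k))
    ⟨j, Finset.mem_univ j, mul_pos (hA i j) (lt_of_le_of_ne (hx j) (Ne.symm hj))⟩

theorem ne_zero_of_mem_stdSimplex {x : ι → ℝ} (hx : x ∈ stdSimplex ℝ ι) : x ≠ 0 := by
  rintro rfl
  simpa using hx.2

theorem le_one_of_mem_stdSimplex {x : ι → ℝ} (hx : x ∈ stdSimplex ℝ ι) (i : ι) : x i ≤ 1 :=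
  hx.2 ▸ Finset.single_le_sum (fun j _ => hx.1 j) (Finset.mem_univ i)

theorem smul_inv_sum_mem_stdSimplex {x : ι → ℝ} (hx : ∀ i, 0 ≤ x i) (hs : 0 < ∑ i, x i) :
    (∑ i, x i)⁻¹ • x ∈ stdSimplex ℝ ι := by
  refine ⟨fun i => mul_nonneg (inv_nonneg.2 hs.le) (hx i), ?_⟩
  simp only [Pi.smul_apply, smul_eq_mul, ← Finset.mul_sum]
  exact inv_mul_cancel₀ hs.ne'

theorem sum_mulVec_le {A : Matrix ι ι ℝ} (hA : ∀ i j, 0 ≤ A i j) {x : ι → ℝ}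
    (hx : x ∈ stdSimplex ℝ ι) : ∑ i, (A *ᵥ x) i ≤ ∑ i, ∑ j, A i j :=
  Finset.sum_le_sum fun i _ => Finset.sum_le_sum fun j _ =>
    mul_le_of_le_one_right (hA i j) (le_one_of_mem_stdSimplex hx j)

/-- If `A y < t y` coordinatewise, then `t` can be decreased. -/
theorem exists_lt_of_mulVec_lt [Nonempty ι] {A : Matrix ι ι ℝ} {y : ι → ℝ} {t : ℝ}
    (hy : ∀ i, 0 < y i) (h : ∀ i, (A *ᵥ y) i < t * y i) :
    ∃ s < t, ∀ i, (A *ᵥ y) i ≤ s * y i := by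
  obtain ⟨i₀, hi₀⟩ := Finite.exists_max fun i => (A *ᵥ y) i / y i
  exact ⟨(A *ᵥ y) i₀ / y i₀, (div_lt_iff₀ (hy i₀)).2 (h i₀),
    fun i => (div_le_iff₀ (hy i)).1 (hi₀ i)⟩

/-- Perron's theorem: a positive matrix has a positive eigenvector. -/
theorem exists_pos_eigenvector_of_pos [Nonempty ι] {A : Matrix ι ι ℝ} (hA : ∀ i j, 0 < A i j) :
    ∃ r : ℝ, 0 ≤ r ∧ ∃ x ∈ stdSimplex ℝ ι, (∀ i, 0 < x i) ∧ A *ᵥ x = r • x := by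
  classical
  have hA' : ∀ i j, 0 ≤ A i j := fun i j => (hA i j).le
  set T : ℝ := ∑ i, ∑ j, A i j with hT
  have hrow : ∀ i, ∑ j, A i j ≤ T := fun i =>
    Finset.single_le_sum (f := fun i => ∑ j, A i j)
      (fun k _ => Finset.sum_nonneg fun j _ => hA' k j) (Finset.mem_univ i)
  have hT0 : 0 ≤ T := Finset.sum_nonneg fun i _ => Finset.sum_nonneg fun j _ => hA' i j
  -- The least `r` with `A x ≤ r x` on the simplex is sought; the cutoff `T` gives compactness and
  -- still admits the normalized constant vector.
  let K : Set (ℝ × (ι → ℝ)) :=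
    (Set.Icc 0 T ×ˢ stdSimplex ℝ ι) ∩ {p | ∀ i, (A *ᵥ p.2) i ≤ p.1 * p.2 i}
  have hK : IsCompact K := by
    refine (isCompact_Icc.prod (isCompact_stdSimplex ℝ ι)).inter_right ?_
    simp only [Set.ofPred_forall]
    refine isClosed_iInter fun i => isClosed_le ?_ (by fun_prop)
    simp only [Matrix.mulVec, dotProduct]
    fun_prop
  have hne : K.Nonempty := by
    have hs : 0 < ∑ _i : ι, (1 : ℝ) := by simp [Fintype.card_pos]
    refine ⟨(T, (∑ _i : ι, (1 : ℝ))⁻¹ • fun _ => 1), ⟨⟨⟨hT0, le_rfl⟩,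
      smul_inv_sum_mem_stdSimplex (fun _ => zero_le_one) hs⟩, fun i => ?_⟩⟩
    simp only [Matrix.mulVec_smul, Pi.smul_apply, smul_eq_mul, mul_one]
    rw [mul_comm T]
    refine mul_le_mul_of_nonneg_left ?_ (inv_nonneg.2 hs.le)
    simpa [Matrix.mulVec, dotProduct] using hrow i
  obtain ⟨⟨r, x⟩, ⟨⟨⟨hr0, hrT⟩, hxs⟩, hle⟩, hmin⟩ :=
    hK.exists_isMinOn hne continuous_fst.continuousOn
  simp only [Set.mem_ofPred_eq] at hle hr0 hrT hxs
  have hx0 := ne_zero_of_mem_stdSimplex hxs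
  have hAx := mulVec_apply_pos hA hxs.1 hx0
  have hxpos : ∀ i, 0 < x i := fun i => by
    have h := (hAx i).trans_le (hle i)
    exact pos_of_mul_pos_right h hr0
  refine ⟨r, hr0, x, hxs, hxpos, ?_⟩
  by_contra hne'
  have hz : ∀ i, 0 ≤ (r • x - A *ᵥ x) i := fun i => sub_nonneg.2 (hle i)
  have hz0 : r • x - A *ᵥ x ≠ 0 := fun h => hne' (sub_eq_zero.1 h).symm
  -- Applying the positive `A` to the nonzero slack `r x - A x` makes it strictly positive, so `A x`
  -- is a better test vector than `x`.
  have hlt : ∀ i, (A *ᵥ (A *ᵥ x)) i < r * (A *ᵥ x) i := fun i => by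
    have := mulVec_apply_pos hA hz hz0 i
    simpa [Matrix.mulVec_sub, Matrix.mulVec_smul] using this
  obtain ⟨s, hs, hsle⟩ := exists_lt_of_mulVec_lt hAx hlt
  have hs0 : 0 ≤ s := by
    obtain ⟨i⟩ := ‹Nonempty ι›
    exact (pos_of_mul_pos_left ((mulVec_apply_pos hA (fun i => (hAx i).le)
      (fun h => (hAx i).ne' (congrFun h i)) i).trans_le (hsle i)) (hAx i).le).le
  have hsum : 0 < ∑ i, (A *ᵥ x) i := Finset.sum_pos (fun i _ => hAx i) Finset.univ_nonempty
  have hmem : (s, (∑ i, (A *ᵥ x) i)⁻¹ • (A *ᵥ x)) ∈ K := by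
    refine ⟨⟨⟨hs0, hs.le.trans hrT⟩, smul_inv_sum_mem_stdSimplex (fun i => (hAx i).le) hsum⟩,
      fun i => ?_⟩
    simp only [Matrix.mulVec_smul, Pi.smul_apply, smul_eq_mul]
    rw [mul_left_comm]
    exact mul_le_mul_of_nonneg_left (hsle i) (inv_nonneg.2 hsum.le)
  exact absurd (hmin hmem) (not_le.2 hs)

/-- A nonnegative matrix has a nonnegative eigenvector whose eigenvalue is a limit of
Collatz-Wielandt bounds of positive vectors. -/
theorem exists_nonneg_eigenvector [Nonempty ι] {A : Matrix ι ι ℝ} (hA : ∀ i j, 0 ≤ A i j) :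
    ∃ r : ℝ, 0 ≤ r ∧ (∃ y : ι → ℝ, (∀ i, 0 ≤ y i) ∧ y ≠ 0 ∧ A *ᵥ y = r • y) ∧
      ∀ t, r < t → ∃ x : ι → ℝ, (∀ i, 0 < x i) ∧ ∀ i, (A *ᵥ x) i ≤ t * x i := by
  have hδ : ∀ n : ℕ, (0 : ℝ) < 1 / ((n : ℝ) + 1) := fun n => Nat.one_div_pos_of_nat
  let B : ℕ → Matrix ι ι ℝ := fun n => A + Matrix.of fun _ _ => 1 / ((n : ℝ) + 1)
  have hB : ∀ n i j, B n i j = A i j + 1 / ((n : ℝ) + 1) := fun n i j => rfl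
  have hBpos : ∀ n i j, 0 < B n i j := fun n i j => by
    rw [hB]; exact add_pos_of_nonneg_of_pos (hA i j) (hδ n)
  choose r hr0 x hxs hxpos hBx using fun n => exists_pos_eigenvector_of_pos (hBpos n)
  -- Summing the eigenvector equation over the simplex bounds all `r n` by `T`, since each
  -- perturbation is at most 1.
  set T : ℝ := ∑ i, ∑ j, (A i j + 1)
  have hrT : ∀ n, r n ≤ T := fun n => by
    have h1 := sum_mulVec_le (fun i j => (hBpos n i j).le) (hxs n)
    rw [hBx n] at h1
    simp only [Pi.smul_apply, smul_eq_mul, ← Finset.mul_sum, (hxs n).2, mul_one] at h1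
    refine h1.trans (Finset.sum_le_sum fun i _ => Finset.sum_le_sum fun j _ => ?_)
    rw [hB]
    gcongr
    rw [div_le_one (by positivity)]
    linarith [(Nat.cast_nonneg n : (0 : ℝ) ≤ n)]
  obtain ⟨⟨ρ, y⟩, ⟨hρ, hy⟩, φ, hφ, hlim⟩ :=
    ((isCompact_Icc (a := (0 : ℝ)) (b := T)).prod (isCompact_stdSimplex ℝ ι)).tendsto_subseq
      (x := fun n => (r n, x n)) fun n => ⟨⟨hr0 n, hrT n⟩, hxs n⟩
  have hlim1 : Filter.Tendsto (fun n => r (φ n)) Filter.atTop (nhds ρ) :=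
    (continuous_fst.tendsto _).comp hlim
  have hlim2 : ∀ j, Filter.Tendsto (fun n => x (φ n) j) Filter.atTop (nhds (y j)) := fun j =>
    (((continuous_apply j).comp continuous_snd).tendsto _).comp hlim
  have hlimB : ∀ i j, Filter.Tendsto (fun n => B (φ n) i j) Filter.atTop (nhds (A i j)) := by
    intro i j
    have := (tendsto_one_div_add_atTop_nhds_zero_nat (𝕜 := ℝ)).comp hφ.tendsto_atTop
    simpa [hB] using this.const_add (A i j)
  refine ⟨ρ, hρ.1, ⟨y, hy.1, ne_zero_of_mem_stdSimplex hy, ?_⟩, fun t ht => ?_⟩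
  · funext i
    refine tendsto_nhds_unique (f := fun n => (B (φ n) *ᵥ x (φ n)) i) (l := Filter.atTop) ?_ ?_
    · exact tendsto_finsetSum _ fun j _ => (hlimB i j).mul (hlim2 j)
    · simp only [hBx, Pi.smul_apply, smul_eq_mul]
      exact hlim1.mul (hlim2 i)
  · obtain ⟨n, hn⟩ := (hlim1.eventually (gt_mem_nhds ht)).exists
    refine ⟨x (φ n), hxpos _, fun i => ?_⟩
    have h1 : (A *ᵥ x (φ n)) i ≤ (B (φ n) *ᵥ x (φ n)) i :=
      Finset.sum_le_sum fun j _ => mul_le_mul_of_nonneg_right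
        ((le_add_of_nonneg_right (hδ (φ n)).le).trans_eq (hB _ i j).symm) (hxpos _ j).le
    rw [hBx] at h1
    exact h1.trans (mul_le_mul_of_nonneg_right hn.le (hxpos _ i).le)

/-- Collatz-Wielandt upper bound for the absolute values of the eigenvalues. -/
theorem norm_le_of_mulVec_le {A : Matrix ι ι ℝ} (hA : ∀ i j, 0 ≤ A i j) {x : ι → ℝ} {t : ℝ}
    (hx : ∀ i, 0 < x i) (h : ∀ i, (A *ᵥ x) i ≤ t * x i) {c : ℂ} {z : ι → ℂ} (hz : z ≠ 0)
    (hc : A.map (algebraMap ℝ ℂ) *ᵥ z = c • z) : ‖c‖ ≤ t := by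
  obtain ⟨k, hk⟩ := Function.ne_iff.1 hz
  have : Nonempty ι := ⟨k⟩
  -- With `d` the largest ratio, `‖z j‖ ≤ d * x j` for all `j`, with equality at `i`; row `i` of the
  -- eigenvalue equation gives the bound.
  obtain ⟨i, hi⟩ := Finite.exists_max fun i => ‖z i‖ / x i
  have hzi : 0 < ‖z i‖ := by
    have : 0 < ‖z i‖ / x i := (div_pos (norm_pos_iff.2 hk) (hx k)).trans_le (hi k)
    exact (div_pos_iff_of_pos_right (hx i)).1 this
  set d := ‖z i‖ / x i
  have hd : d * x i = ‖z i‖ := div_mul_cancel₀ _ (hx i).ne'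
  have hd0 : 0 ≤ d := div_nonneg (norm_nonneg _) (hx i).le
  have h1 : ‖c‖ * ‖z i‖ ≤ ∑ j, A i j * ‖z j‖ := by
    rw [← norm_mul, ← smul_eq_mul, ← Pi.smul_apply, ← hc]
    refine (norm_sum_le _ _).trans_eq (Finset.sum_congr rfl fun j _ => ?_)
    simp [abs_of_nonneg (hA i j)]
  have h2 : ∑ j, A i j * ‖z j‖ ≤ d * (A *ᵥ x) i := by
    rw [Matrix.mulVec, dotProduct, Finset.mul_sum]
    refine Finset.sum_le_sum fun j _ => ?_
    rw [mul_left_comm]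
    exact mul_le_mul_of_nonneg_left ((div_le_iff₀ (hx j)).1 (hi j)) (hA i j)
  have h3 : d * (A *ᵥ x) i ≤ t * ‖z i‖ := by
    rw [← hd, mul_left_comm]
    exact mul_le_mul_of_nonneg_left (h i) hd0
  exact le_of_mul_le_mul_right (h1.trans (h2.trans h3)) hzi

/-- A real eigenvalue is at most any Collatz-Wielandt bound. -/
theorem le_of_mulVec_le_of_eigenvector {A : Matrix ι ι ℝ} (hA : ∀ i j, 0 ≤ A i j) {x : ι → ℝ}
    {t : ℝ} (hx : ∀ i, 0 < x i) (h : ∀ i, (A *ᵥ x) i ≤ t * x i) {r : ℝ} {y : ι → ℝ} (hy : y ≠ 0)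
    (hAy : A *ᵥ y = r • y) : r ≤ t := by
  have : ‖(r : ℂ)‖ ≤ t := by
    refine norm_le_of_mulVec_le hA hx h (z := fun i => (y i : ℂ)) (fun h0 => hy ?_) ?_
    · funext i
      simpa using congrFun h0 i
    · funext i
      have := congrArg (algebraMap ℝ ℂ) (congrFun hAy i)
      simpa [Matrix.mulVec, dotProduct] using this
  exact (le_abs_self r).trans (by simpa using this)

/-- A zero coordinate forces all its out-neighbours to be zero, so positivity propagates backwards
along diedges. -/
theorem pos_of_irreducible {A : Matrix ι ι ℝ} (hA : ∀ i j, 0 ≤ A i j) (hirr : Irreducible A)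
    {y : ι → ℝ} (hy : ∀ i, 0 ≤ y i) (hy0 : y ≠ 0) {s : ℝ} (h : ∀ i, (A *ᵥ y) i ≤ s * y i)
    (i : ι) : 0 < y i := by
  obtain ⟨k, hk⟩ := Function.ne_iff.1 hy0
  have hk' : 0 < y k := lt_of_le_of_ne (hy k) (Ne.symm hk)
  by_cases hik : i = k
  · exact hik ▸ hk'
  have step : ∀ a b, 0 < A a b → 0 < y b → 0 < y a := fun a b hab hb => by
    refine lt_of_le_of_ne (hy a) fun h0 => ?_
    have h1 : A a b * y b ≤ (A *ᵥ y) a :=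
      Finset.single_le_sum (f := fun j => A a j * y j) (fun j _ => mul_nonneg (hA a j) (hy j))
        (Finset.mem_univ b)
    have h2 := h a
    rw [← h0, mul_zero] at h2
    linarith [mul_pos hab hb]
  refine Relation.TransGen.head_induction_on (motive := fun a _ => 0 < y a) (hirr i k hik) ?_ ?_
  · exact fun hab => step _ _ hab hk'
  · exact fun hab _ hb => step _ _ hab hb

/-- For irreducible `A`, a positive `x` with `A x ≤ ρ(A) x` is a multiple of the Perron vector. -/
theorem eq_smul_of_irreducible {A : Matrix ι ι ℝ} (hA : ∀ i j, 0 ≤ A i j) (hirr : Irreducible A)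
    [Nonempty ι] {x y : ι → ℝ} {s : ℝ} (h : ∀ i, (A *ᵥ x) i ≤ s * x i)
    (hy : ∀ i, 0 < y i) (hAy : A *ᵥ y = s • y) : ∃ c : ℝ, x = c • y := by
  -- With `c` the smallest ratio, `x - c • y` is nonnegative and vanishes at `k`; were it nonzero,
  -- `pos_of_irreducible` would make it positive there.
  obtain ⟨k, hk⟩ := Finite.exists_min fun i => x i / y i
  refine ⟨x k / y k, ?_⟩
  by_contra hne
  set c := x k / y k
  have hz : ∀ i, 0 ≤ (x - c • y) i := fun i => sub_nonneg.2 ((le_div_iff₀ (hy i)).1 (hk i))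
  have hpos := pos_of_irreducible hA hirr hz (sub_ne_zero.2 hne) (s := s) (fun i => by
    have := h i
    simp only [Matrix.mulVec_sub, Matrix.mulVec_smul, hAy, Pi.sub_apply, Pi.smul_apply,
      smul_eq_mul]
    linarith) k
  have : (x - c • y) k = 0 := by
    simp [c, div_mul_cancel₀ _ (hy k).ne']
  exact hpos.ne' this

variable [DecidableEq ι]

theorem mem_spectrum_iff_exists_mulVec {K : Type*} [Field K] (M : Matrix ι ι K) (c : K) :
    c ∈ spectrum K M ↔ ∃ z : ι → K, z ≠ 0 ∧ M *ᵥ z = c • z := by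
  rw [spectrum.mem_iff, Matrix.isUnit_iff_isUnit_det, isUnit_iff_ne_zero, not_not,
    ← Matrix.exists_mulVec_eq_zero_iff]
  refine exists_congr fun z => and_congr_right fun _ => ?_
  rw [Matrix.sub_mulVec, sub_eq_zero, Algebra.algebraMap_eq_smul_one, Matrix.smul_mulVec,
    Matrix.one_mulVec, eq_comm]

theorem specRadius_eq_of_forall {A : Matrix ι ι ℝ} {r : ℝ} (hr : 0 ≤ r) {y : ι → ℝ} (hy : y ≠ 0)
    (hAy : A *ᵥ y = r • y)
    (h : ∀ (c : ℂ) (z : ι → ℂ), z ≠ 0 → A.map (algebraMap ℝ ℂ) *ᵥ z = c • z → ‖c‖ ≤ r) :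
    specRadius A = r := by
  have key : spectralRadius ℂ (A.map (algebraMap ℝ ℂ)) = ENNReal.ofReal r := by
    refine le_antisymm (iSup₂_le fun c hc => ?_) ?_
    · obtain ⟨z, hz, hcz⟩ := (mem_spectrum_iff_exists_mulVec _ _).1 hc
      rw [← ENNReal.ofReal_coe_nnreal]
      exact ENNReal.ofReal_le_ofReal (h c z hz hcz)
    · have hmem : (r : ℂ) ∈ spectrum ℂ (A.map (algebraMap ℝ ℂ)) := by
        refine (mem_spectrum_iff_exists_mulVec _ _).2 ⟨fun i => (y i : ℂ), fun h0 => hy ?_, ?_⟩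
        · funext i
          simpa using congrFun h0 i
        · funext i
          have := congrArg (algebraMap ℝ ℂ) (congrFun hAy i)
          simpa [Matrix.mulVec, dotProduct] using this
      refine le_trans (le_of_eq ?_) (le_iSup₂ (f := fun (c : ℂ) (_ : c ∈ spectrum ℂ
        (A.map (algebraMap ℝ ℂ))) => (‖c‖₊ : ℝ≥0∞)) (r : ℂ) hmem)
      rw [← ENNReal.ofReal_coe_nnreal]
      simp [abs_of_nonneg hr]
  rw [specRadius, key, ENNReal.toReal_ofReal hr]

theorem specRadius_nonneg (A : Matrix ι ι ℝ) : 0 ≤ specRadius A := ENNReal.toReal_nonneg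

/-- The inequality `specRadius A < t` is strict because a positive vector need not attain the
infimum. -/
theorem specRadius_spec [Nonempty ι] {A : Matrix ι ι ℝ} (hA : ∀ i j, 0 ≤ A i j) :
    (∃ y : ι → ℝ, (∀ i, 0 ≤ y i) ∧ y ≠ 0 ∧ A *ᵥ y = specRadius A • y) ∧
      ∀ t, specRadius A < t → ∃ x : ι → ℝ, (∀ i, 0 < x i) ∧ ∀ i, (A *ᵥ x) i ≤ t * x i := by
  obtain ⟨r, hr, ⟨y, hy, hy0, hAy⟩, hx⟩ := exists_nonneg_eigenvector hA
  have : specRadius A = r := by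
    refine specRadius_eq_of_forall hr hy0 hAy fun c z hz hc => le_of_forall_gt_imp_ge_of_dense ?_
    intro t ht
    obtain ⟨x, hxpos, hle⟩ := hx t ht
    exact norm_le_of_mulVec_le hA hxpos hle hz hc
  rw [this]
  exact ⟨⟨y, hy, hy0, hAy⟩, hx⟩

theorem specRadius_le_of_mulVec_le [Nonempty ι] {A : Matrix ι ι ℝ} (hA : ∀ i j, 0 ≤ A i j)
    {x : ι → ℝ} {t : ℝ} (hx : ∀ i, 0 < x i) (h : ∀ i, (A *ᵥ x) i ≤ t * x i) :
    specRadius A ≤ t := by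
  obtain ⟨y, -, hy0, hAy⟩ := (specRadius_spec hA).1
  exact le_of_mulVec_le_of_eigenvector hA hx h hy0 hAy

theorem le_specRadius_of_eigenvector {A : Matrix ι ι ℝ} (hA : ∀ i j, 0 ≤ A i j) {r : ℝ}
    {y : ι → ℝ} (hy : y ≠ 0) (hAy : A *ᵥ y = r • y) : r ≤ specRadius A := by
  obtain ⟨k, -⟩ := Function.ne_iff.1 hy
  have : Nonempty ι := ⟨k⟩
  refine le_of_forall_gt_imp_ge_of_dense fun t ht => ?_
  obtain ⟨x, hx, hle⟩ := (specRadius_spec hA).2 t ht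
  exact le_of_mulVec_le_of_eigenvector hA hx hle hy hAy

theorem exists_pos_eigenvector_of_irreducible [Nonempty ι] {A : Matrix ι ι ℝ}
    (hA : ∀ i j, 0 ≤ A i j) (hirr : Irreducible A) :
    ∃ y : ι → ℝ, (∀ i, 0 < y i) ∧ A *ᵥ y = specRadius A • y := by
  obtain ⟨y, hy, hy0, hAy⟩ := (specRadius_spec hA).1
  exact ⟨y, pos_of_irreducible hA hirr hy hy0 (fun i => (congrFun hAy i).le), hAy⟩

theorem mulVec_eq_of_irreducible [Nonempty ι] {A : Matrix ι ι ℝ} (hA : ∀ i j, 0 ≤ A i j)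
    (hirr : Irreducible A) {x : ι → ℝ} (h : ∀ i, (A *ᵥ x) i ≤ specRadius A * x i) :
    A *ᵥ x = specRadius A • x := by
  obtain ⟨y, hy, hAy⟩ := exists_pos_eigenvector_of_irreducible hA hirr
  obtain ⟨c, rfl⟩ := eq_smul_of_irreducible hA hirr h hy hAy
  rw [Matrix.mulVec_smul, hAy, smul_comm]

/-- Attainment is automatic: the largest quotient is itself a Collatz–Wielandt bound, hence at least
the spectral radius. -/
theorem isGreatest_div_iff [Nonempty ι] {A : Matrix ι ι ℝ} (hA : ∀ i j, 0 ≤ A i j) {x : ι → ℝ}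
    (hx : ∀ i, 0 < x i) :
    IsGreatest (Set.range fun i => (A *ᵥ x) i / x i) (specRadius A) ↔
      ∀ i, (A *ᵥ x) i ≤ specRadius A * x i := by
  constructor
  · exact fun h i => (div_le_iff₀ (hx i)).1 (h.2 ⟨i, rfl⟩)
  · intro h
    have hub : ∀ i, (A *ᵥ x) i / x i ≤ specRadius A := fun i => (div_le_iff₀ (hx i)).2 (h i)
    obtain ⟨k, hk⟩ := Finite.exists_max fun i => (A *ᵥ x) i / x i
    refine ⟨⟨k, le_antisymm (hub k) ?_⟩, ?_⟩
    · exact specRadius_le_of_mulVec_le hA hx fun i => (div_le_iff₀ (hx i)).1 (hk i)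
    · rintro _ ⟨i, rfl⟩
      exact hub i

end PerronFrobenius

/-! ### Strong components, sinks and sources. -/

section Digraph

open Relation

variable {V : Type*} [Fintype V] {G : Digraph V}

/-- The vertices mutually reachable with `v`. -/
noncomputable def componentOf (G : Digraph V) (v : V) : Finset V := by
  classical exact {w | ReflTransGen G.Adj v w ∧ ReflTransGen G.Adj w v}

theorem mem_componentOf {v w : V} :
    w ∈ componentOf G v ↔ ReflTransGen G.Adj v w ∧ ReflTransGen G.Adj w v := by
  simp [componentOf]

theorem self_mem_componentOf (v : V) : v ∈ componentOf G v :=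
  mem_componentOf.2 ⟨.refl, .refl⟩

/-- Every intermediate vertex of the path is reachable from `v` and reaches `v`, so the path stays
in the component. -/
theorem reflTransGen_inducedSubdigraph {v a b : V} (ha : a ∈ componentOf G v)
    (hb : b ∈ componentOf G v) (h : ReflTransGen G.Adj a b) :
    ReflTransGen (inducedSubdigraph G (componentOf G v)).Adj ⟨a, ha⟩ ⟨b, hb⟩ := by
  induction h using ReflTransGen.head_induction_on with
  | refl => exact .refl
  | head hac hcb ih =>
    have hc := mem_componentOf.2
      ⟨(mem_componentOf.1 ha).1.tail hac, hcb.trans (mem_componentOf.1 hb).2⟩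
    have hac' : (inducedSubdigraph G (componentOf G v)).Adj ⟨_, ha⟩ ⟨_, hc⟩ := hac
    exact (ih hc).head hac'

theorem stronglyConnected_componentOf (v : V) :
    StronglyConnected (inducedSubdigraph G (componentOf G v)) := by
  rintro ⟨a, ha⟩ ⟨b, hb⟩ hab
  have h := reflTransGen_inducedSubdigraph ha hb
    ((mem_componentOf.1 ha).2.trans (mem_componentOf.1 hb).1)
  exact (reflTransGen_iff_eq_or_transGen.1 h).resolve_left (Ne.symm hab)

theorem subset_componentOf {U : Finset V} (hU : StronglyConnected (inducedSubdigraph G U))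
    {v : V} (hv : v ∈ U) : U ⊆ componentOf G v := by
  have key : ∀ a b : U, ReflTransGen G.Adj (a : V) b := fun a b => by
    by_cases hab : a = b
    · exact hab ▸ .refl
    · exact ((hU a b hab).lift Subtype.val fun _ _ h => h).to_reflTransGen
  exact fun w hw => mem_componentOf.2 ⟨key ⟨v, hv⟩ ⟨w, hw⟩, key ⟨w, hw⟩ ⟨v, hv⟩⟩

theorem isStrongComponent_componentOf (v : V) : IsStrongComponent G (componentOf G v) :=
  ⟨⟨⟨v, self_mem_componentOf v⟩, stronglyConnected_componentOf v⟩,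
    fun _ hU hle => subset_componentOf hU.2 (hle (self_mem_componentOf v))⟩

theorem IsStrongComponent.eq_componentOf {U : Finset V} (hU : IsStrongComponent G U) {v : V}
    (hv : v ∈ U) : U = componentOf G v :=
  hU.eq_of_le (isStrongComponent_componentOf v).1 (subset_componentOf hU.1.2 hv)

theorem componentOf_eq {v w : V} (h : w ∈ componentOf G v) : componentOf G v = componentOf G w :=
  (isStrongComponent_componentOf v).eq_componentOf h

theorem isSink_reducedDigraph_iff (P : StrongComponent G) :
    IsSink (reducedDigraph G) P ↔ ∀ v ∈ P.1, ∀ w, G.Adj v w → w ∈ P.1 := by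
  constructor
  · intro h v hv w hvw
    by_contra hw
    refine h ⟨_, isStrongComponent_componentOf w⟩
      ⟨fun hP => hw ?_, v, hv, w, self_mem_componentOf w, hvw⟩
    rw [hP]
    exact self_mem_componentOf w
  · rintro h Q ⟨hPQ, v, hv, w, hw, hvw⟩
    refine hPQ (Subtype.ext ?_)
    rw [P.2.eq_componentOf (h v hv w hvw), Q.2.eq_componentOf hw]

theorem isSource_reducedDigraph_iff (P : StrongComponent G) :
    IsSource (reducedDigraph G) P ↔ ∀ w ∈ P.1, ∀ v, G.Adj v w → v ∈ P.1 := by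
  constructor
  · intro h w hw v hvw
    by_contra hv
    refine h ⟨_, isStrongComponent_componentOf v⟩
      ⟨fun hP => hv ?_, v, self_mem_componentOf v, w, hw, hvw⟩
    rw [← hP]
    exact self_mem_componentOf v
  · rintro h Q ⟨hQP, v, hv, w, hw, hvw⟩
    refine hQP (Subtype.ext ?_)
    rw [P.2.eq_componentOf (h w hw v hvw), Q.2.eq_componentOf hv]

/-- In a nonempty set of vertices there is one that can be reached back from every vertex of
the set reachable from it. -/
theorem exists_terminal (r : V → V → Prop) {S : Set V} (hS : S.Nonempty) :
    ∃ v ∈ S, ∀ w ∈ S, ReflTransGen r v w → ReflTransGen r w v := by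
  classical
  -- Minimize the number of reachable vertices: any `w ∈ S` reachable from `v` then has the same
  -- reachable set, which contains `v`.
  obtain ⟨v, hv, hmin⟩ := Set.exists_min_image S
    (fun v => (Finset.univ.filter fun w => ReflTransGen r v w).card) S.toFinite hS
  refine ⟨v, hv, fun w hw hvw => ?_⟩
  have hsub : (Finset.univ.filter fun u => ReflTransGen r w u) ⊆
      Finset.univ.filter fun u => ReflTransGen r v u :=
    Finset.monotone_filter_right _ fun u _ hu => hvw.trans hu
  have heq := Finset.eq_of_subset_of_card_le hsub (hmin w hw)
  have : v ∈ Finset.univ.filter fun u => ReflTransGen r w u := by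
    rw [heq]
    simp [ReflTransGen.refl]
  simpa using this

/-- A nonempty set of vertices closed under predecessors contains a source component. -/
theorem exists_isSource_subset {S : Set V} (hS : S.Nonempty)
    (hclosed : ∀ v w, G.Adj v w → w ∈ S → v ∈ S) :
    ∃ P : StrongComponent G, IsSource (reducedDigraph G) P ∧ ∀ v ∈ P.1, v ∈ S := by
  -- Reversing the diedges turns a terminal vertex into one that reaches all of its ancestors in
  -- `S`.
  obtain ⟨v, hv, hmin⟩ := exists_terminal (Function.swap G.Adj) hS
  have hreach : ∀ u, ReflTransGen G.Adj u v → u ∈ S := fun u hu => by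
    induction hu using ReflTransGen.head_induction_on with
    | refl => exact hv
    | head hac _ ih => exact hclosed _ _ hac ih
  refine ⟨⟨_, isStrongComponent_componentOf v⟩, (isSource_reducedDigraph_iff _).2 ?_,
    fun u hu => hreach u (mem_componentOf.1 hu).2⟩
  intro w hw u huw
  have huv : ReflTransGen G.Adj u v := (mem_componentOf.1 hw).2.head huw
  exact mem_componentOf.2
    ⟨reflTransGen_swap.1 (hmin u (hreach u huv) (reflTransGen_swap.2 huv)), huv⟩

end Digraph

/-! ### Principal submatrices on components. -/

section Components

variable {ι : Type*} {A : Matrix ι ι ℝ}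

theorem principalSubmatrix_mulVec (A : Matrix ι ι ℝ) (U : Finset ι) (x : ι → ℝ) (i : U) :
    (principalSubmatrix A U *ᵥ fun j => x j) i = ∑ j ∈ U, A i j * x j :=
  Finset.sum_coe_sort U fun j => A i j * x j

theorem irreducible_principalSubmatrix (V : StrongComponent (matrixDigraph A)) :
    Irreducible (principalSubmatrix A V.1) :=
  V.2.1.2

theorem exists_extension [DecidableEq ι] (U : Finset ι) (y : U → ℝ) :
    ∃ x : ι → ℝ, (∀ i : U, x i = y i) ∧ ∀ i, i ∉ U → x i = 0 :=
  ⟨fun i => if h : i ∈ U then y ⟨i, h⟩ else 0, fun i => by simp, fun i hi => by simp [hi]⟩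

theorem sum_le_mulVec [Fintype ι] (hA : ∀ i j, 0 ≤ A i j) {x : ι → ℝ} (hx : ∀ i, 0 ≤ x i)
    (U : Finset ι) (i : ι) : ∑ j ∈ U, A i j * x j ≤ (A *ᵥ x) i :=
  Finset.sum_le_univ_sum_of_nonneg fun j => mul_nonneg (hA i j) (hx j)

variable [DecidableEq ι]

theorem specRadius_principalSubmatrix_le_of_mulVec_le (hA : ∀ i j, 0 ≤ A i j) {U : Finset ι}
    (hU : U.Nonempty) {x : ι → ℝ} {t : ℝ} (hx : ∀ i ∈ U, 0 < x i)
    (h : ∀ i ∈ U, ∑ j ∈ U, A i j * x j ≤ t * x i) :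
    specRadius (principalSubmatrix A U) ≤ t := by
  have := hU.to_subtype
  refine specRadius_le_of_mulVec_le (A := principalSubmatrix A U) (x := fun j : U => x j)
    (fun i j => hA i j) (fun i => hx i i.2) fun i => ?_
  rw [principalSubmatrix_mulVec]
  exact h i i.2

theorem exists_pos_sum_le (hA : ∀ i j, 0 ≤ A i j) {U : Finset ι} (hU : U.Nonempty) {t : ℝ}
    (ht : specRadius (principalSubmatrix A U) < t) :
    ∃ x : ι → ℝ, (∀ i ∈ U, 0 < x i) ∧ ∀ i ∈ U, ∑ j ∈ U, A i j * x j ≤ t * x i := by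
  have := hU.to_subtype
  obtain ⟨y, hy, hle⟩ := (specRadius_spec (A := principalSubmatrix A U) fun i j => hA i j).2 t ht
  obtain ⟨x, hx, -⟩ := exists_extension U y
  obtain rfl : (fun i : U => x i) = y := funext hx
  refine ⟨x, fun i hi => hy ⟨i, hi⟩, fun i hi => ?_⟩
  have := hle ⟨i, hi⟩
  rwa [principalSubmatrix_mulVec] at this

/-- The Perron vector of a strongly connected component, extended by zero. -/
theorem exists_perron_of_strongComponent (hA : ∀ i j, 0 ≤ A i j)
    (V : StrongComponent (matrixDigraph A)) :
    ∃ x : ι → ℝ, (∀ i ∈ V.1, 0 < x i) ∧ (∀ i, i ∉ V.1 → x i = 0) ∧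
      ∀ i ∈ V.1, ∑ j ∈ V.1, A i j * x j = specRadius (principalSubmatrix A V.1) * x i := by
  have := V.2.1.1.to_subtype
  obtain ⟨y, hy, hAy⟩ := exists_pos_eigenvector_of_irreducible
    (A := principalSubmatrix A V.1) (fun i j => hA i j) (irreducible_principalSubmatrix V)
  obtain ⟨x, hx, hx0⟩ := exists_extension V.1 y
  obtain rfl : (fun i : V.1 => x i) = y := funext hx
  refine ⟨x, fun i hi => hy ⟨i, hi⟩, hx0, fun i hi => ?_⟩
  have := congrFun hAy ⟨i, hi⟩
  rwa [principalSubmatrix_mulVec] at this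

variable [Fintype ι]

theorem mulVec_eq_sum_add_sum_compl (A : Matrix ι ι ℝ) (U : Finset ι) (x : ι → ℝ) (i : ι) :
    (A *ᵥ x) i = ∑ j ∈ U, A i j * x j + ∑ j ∈ Uᶜ, A i j * x j :=
  (Finset.sum_add_sum_compl U fun j => A i j * x j).symm

theorem specRadius_principalSubmatrix_le [Nonempty ι] (hA : ∀ i j, 0 ≤ A i j) {U : Finset ι}
    (hU : U.Nonempty) : specRadius (principalSubmatrix A U) ≤ specRadius A := by
  refine le_of_forall_gt_imp_ge_of_dense fun t ht => ?_
  obtain ⟨x, hx, hle⟩ := (specRadius_spec hA).2 t ht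
  exact specRadius_principalSubmatrix_le_of_mulVec_le hA hU (fun i _ => hx i) fun i _ =>
    (sum_le_mulVec hA (fun i => (hx i).le) U i).trans (hle i)

/-- The spectral radius of a union of components is at most that of one of them. -/
theorem exists_specRadius_le_componentOf (hA : ∀ i j, 0 ≤ A i j) {T : Finset ι}
    (hT : T.Nonempty) (hcomp : ∀ v ∈ T, componentOf (matrixDigraph A) v ⊆ T) :
    ∃ v ∈ T, specRadius (principalSubmatrix A T) ≤
      specRadius (principalSubmatrix A (componentOf (matrixDigraph A) v)) := by
  have := hT.to_subtype
  obtain ⟨y, -, hy0, hAy⟩ := (specRadius_spec (A := principalSubmatrix A T) fun i j => hA i j).1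
  obtain ⟨x, hx, hx0⟩ := exists_extension T y
  obtain rfl : (fun i : T => x i) = y := funext hx
  obtain ⟨k, hk⟩ := Function.ne_iff.1 hy0
  -- Terminality within the support means that a nonzero term `A i j * x j` with `i` in the
  -- component of `v` has `j` there too. So `x` restricts to an eigenvector of that block.
  obtain ⟨v, hv, hterm⟩ := exists_terminal (matrixDigraph A).Adj (S := {i | x i ≠ 0}) ⟨k, hk⟩
  have hvT : v ∈ T := by
    by_contra h
    exact hv (hx0 v h)
  refine ⟨v, hvT, ?_⟩
  set C := componentOf (matrixDigraph A) v with hC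
  have hvC : v ∈ C := self_mem_componentOf v
  refine le_specRadius_of_eigenvector (A := principalSubmatrix A C) (fun i j => hA i j)
    (y := fun i : C => x i) (fun h => hv (congrFun h ⟨v, hvC⟩)) ?_
  funext i
  have hi := congrFun hAy ⟨i, hcomp v hvT i.2⟩
  rw [principalSubmatrix_mulVec] at hi ⊢
  refine (Finset.sum_subset (hcomp v hvT) fun j _ hjC => ?_).trans hi
  by_contra hne
  obtain ⟨hAij, hxj⟩ := mul_ne_zero_iff.1 hne
  have hreach : Relation.ReflTransGen (matrixDigraph A).Adj v j :=
    (mem_componentOf.1 i.2).1.tail (lt_of_le_of_ne (hA i j) (Ne.symm hAij))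
  exact hjC (mem_componentOf.2 ⟨hreach, hterm j hxj hreach⟩)

/-- By irreducibility the inequality restricted to `V` is an equality, so a diedge leaving `V` would
add a positive term to a saturated row. -/
theorem isSink_of_mulVec_le (hA : ∀ i j, 0 ≤ A i j) {x : ι → ℝ} (hx : ∀ i, 0 < x i)
    (V : StrongComponent (matrixDigraph A))
    (h : ∀ i, (A *ᵥ x) i ≤ specRadius (principalSubmatrix A V.1) * x i) :
    IsSink (reducedDigraph (matrixDigraph A)) V := by
  have := V.2.1.1.to_subtype
  have heq := mulVec_eq_of_irreducible (A := principalSubmatrix A V.1) (fun i j => hA i j)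
    (irreducible_principalSubmatrix V) (x := fun i => x i) fun i => by
      rw [principalSubmatrix_mulVec]
      exact (sum_le_mulVec hA (fun i => (hx i).le) V.1 i).trans (h i)
  refine (isSink_reducedDigraph_iff V).2 fun v hv w hvw => ?_
  by_contra hw
  have h1 := congrFun heq ⟨v, hv⟩
  rw [principalSubmatrix_mulVec] at h1
  have h2 := h v
  rw [mulVec_eq_sum_add_sum_compl A V.1, h1] at h2
  have h3 : 0 < ∑ j ∈ V.1ᶜ, A v j * x j :=
    Finset.sum_pos' (fun j _ => mul_nonneg (hA v j) (hx j).le)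
      ⟨w, Finset.mem_compl.2 hw, mul_pos hvw (hx w)⟩
  simp only [Pi.smul_apply, smul_eq_mul] at h2
  linarith

/-- If the components of maximal spectral radius are sinks, the Collatz-Wielandt infimum is
attained at a positive vector. -/
theorem exists_pos_mulVec_le_of_isSink [Nonempty ι] (hA : ∀ i j, 0 ≤ A i j)
    (hsink : ∀ V : StrongComponent (matrixDigraph A),
      specRadius (principalSubmatrix A V.1) = specRadius A →
        IsSink (reducedDigraph (matrixDigraph A)) V) :
    ∃ x : ι → ℝ, (∀ i, 0 < x i) ∧ ∀ i, (A *ᵥ x) i ≤ specRadius A * x i := by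
  classical
  let comp : ι → StrongComponent (matrixDigraph A) := fun v =>
    ⟨componentOf (matrixDigraph A) v, isStrongComponent_componentOf v⟩
  have hself : ∀ i, i ∈ (comp i).1 := self_mem_componentOf
  have hcomp : ∀ i, ∀ j ∈ (comp i).1, comp j = comp i := fun i j hj =>
    Subtype.ext (componentOf_eq hj).symm
  choose u hu _ hAu using exists_perron_of_strongComponent hA
  let S : Finset ι := Finset.univ.filter fun i =>
    specRadius (principalSubmatrix A (comp i).1) = specRadius A
  have hS : ∀ i, i ∈ S ↔ specRadius (principalSubmatrix A (comp i).1) = specRadius A := by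
    simp [S]
  obtain ⟨t, ht, z, hz, hAz⟩ : ∃ t < specRadius A, ∃ z : ι → ℝ, (∀ i ∈ Sᶜ, 0 < z i) ∧
      ∀ i ∈ Sᶜ, ∑ j ∈ Sᶜ, A i j * z j ≤ t * z i := by
    rcases Sᶜ.eq_empty_or_nonempty with hT | hT
    -- Any `t` below the spectral radius serves here, the conditions being vacuous.
    · exact ⟨specRadius A - 1, sub_one_lt _, 0, by simp [hT]⟩
    · obtain ⟨v, hv, hle⟩ := exists_specRadius_le_componentOf hA hT fun v hv w hw => by
        rw [Finset.mem_compl, hS] at hv ⊢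
        rwa [hcomp v w hw]
      have hlt : specRadius (principalSubmatrix A Sᶜ) < specRadius A :=
        hle.trans_lt (lt_of_le_of_ne (specRadius_principalSubmatrix_le hA ⟨v, hself v⟩)
          fun h => Finset.mem_compl.1 hv ((hS v).2 h))
      obtain ⟨t, ht1, ht2⟩ := exists_between hlt
      exact ⟨t, ht2, exists_pos_sum_le hA hT ht1⟩
  have hδ : 0 < specRadius A - t := sub_pos.2 ht
  let D : ι → ℝ := fun i => ∑ j ∈ S, A i j * u (comp j) j
  -- The scale `c` makes the slack `c * (specRadius A - t) * z i` off `S` dominate the contribution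
  -- `D i` of `S`; the maximum with 1 keeps it positive.
  obtain ⟨c₀, hc₀⟩ := (Set.finite_range fun i => D i / ((specRadius A - t) * z i)).bddAbove
  set c := max c₀ 1
  have hc : 0 < c := zero_lt_one.trans_le (le_max_right _ _)
  have hcD : ∀ i ∈ Sᶜ, D i ≤ c * ((specRadius A - t) * z i) := fun i hi =>
    (div_le_iff₀ (mul_pos hδ (hz i hi))).1 ((hc₀ ⟨i, rfl⟩).trans (le_max_left _ _))
  let x : ι → ℝ := fun i => if i ∈ S then u (comp i) i else c * z i
  have hxS : ∀ i ∈ S, x i = u (comp i) i := fun i hi => if_pos hi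
  have hxT : ∀ i ∈ Sᶜ, x i = c * z i := fun i hi => if_neg (Finset.mem_compl.1 hi)
  refine ⟨x, fun i => ?_, fun i => ?_⟩
  · by_cases hi : i ∈ S
    · rw [hxS i hi]
      exact hu _ i (hself i)
    · rw [hxT i (Finset.mem_compl.2 hi)]
      exact mul_pos hc (hz i (Finset.mem_compl.2 hi))
  · by_cases hi : i ∈ S
    · have hρ := (hS i).1 hi
      have hout := (isSink_reducedDigraph_iff _).1 (hsink (comp i) hρ) i (hself i)
      rw [mulVec_eq_sum_add_sum_compl A (comp i).1, hxS i hi, ← hρ, ← hAu _ i (hself i),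
        Finset.sum_eq_zero (s := (comp i).1ᶜ), add_zero]
      · refine (Finset.sum_congr rfl fun j hj => ?_).le
        rw [hxS j, hcomp i j hj]
        rwa [hS, hcomp i j hj]
      · intro j hj
        by_contra hne
        exact Finset.mem_compl.1 hj
          (hout j (lt_of_le_of_ne (hA i j) (Ne.symm (left_ne_zero_of_mul hne))))
    · have hi' := Finset.mem_compl.2 hi
      have h1 : ∑ j ∈ S, A i j * x j = D i := Finset.sum_congr rfl fun j hj => by rw [hxS j hj]
      have h2 : ∑ j ∈ Sᶜ, A i j * x j = c * ∑ j ∈ Sᶜ, A i j * z j := by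
        rw [Finset.mul_sum]
        exact Finset.sum_congr rfl fun j hj => by rw [hxT j hj, mul_left_comm]
      rw [mulVec_eq_sum_add_sum_compl A S, h1, h2, hxT i hi']
      have h3 := mul_le_mul_of_nonneg_left (hAz i hi') hc.le
      linarith [hcD i hi']

/-- A nonnegative nonzero `x` with `A x ≤ t x` bounds the spectral radius of a source component. -/
theorem exists_isSource_specRadius_le (hA : ∀ i j, 0 ≤ A i j) {x : ι → ℝ} (hx : ∀ i, 0 ≤ x i)
    (hx0 : x ≠ 0) {t : ℝ} (h : ∀ i, (A *ᵥ x) i ≤ t * x i) :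
    ∃ V : StrongComponent (matrixDigraph A), IsSource (reducedDigraph (matrixDigraph A)) V ∧
      specRadius (principalSubmatrix A V.1) ≤ t := by
  obtain ⟨k, hk⟩ := Function.ne_iff.1 hx0
  -- The support is closed under predecessors: `x v = 0` would give `0 < A v w * x w ≤ (A *ᵥ x) v ≤
  -- 0`.
  obtain ⟨V, hV, hVS⟩ := exists_isSource_subset (G := matrixDigraph A) (S := {i | 0 < x i})
    ⟨k, lt_of_le_of_ne (hx k) (Ne.symm hk)⟩ fun v w hvw hw => by
      refine lt_of_le_of_ne (hx v) fun h0 => ?_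
      have h1 := sum_le_mulVec hA hx {w} v
      have h2 := h v
      rw [Finset.sum_singleton] at h1
      rw [← h0, mul_zero] at h2
      exact absurd (h1.trans h2) (not_le.2 (mul_pos hvw hw))
  exact ⟨V, hV, specRadius_principalSubmatrix_le_of_mulVec_le hA V.2.1.1 hVS fun i _ =>
    (sum_le_mulVec hA hx V.1 i).trans (h i)⟩

/-- For the Perron vector extended by zero, rows in `V` see only `V`, and rows outside vanish
because no diedge enters a source. -/
theorem exists_eigenvector_of_isSource (hA : ∀ i j, 0 ≤ A i j)
    {V : StrongComponent (matrixDigraph A)} (hV : IsSource (reducedDigraph (matrixDigraph A)) V) :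
    ∃ w : ι → ℝ, (∀ i, 0 ≤ w i) ∧ w ≠ 0 ∧
      A *ᵥ w = specRadius (principalSubmatrix A V.1) • w := by
  obtain ⟨w, hw, hw0, hAw⟩ := exists_perron_of_strongComponent hA V
  obtain ⟨k, hk⟩ := V.2.1.1
  refine ⟨w, fun i => ?_, fun h => (hw k hk).ne' (congrFun h k), funext fun i => ?_⟩
  · by_cases hi : i ∈ V.1
    · exact (hw i hi).le
    · exact (hw0 i hi).ge
  · rw [mulVec_eq_sum_add_sum_compl A V.1,
      Finset.sum_eq_zero (s := V.1ᶜ) fun j hj => by rw [hw0 j (Finset.mem_compl.1 hj), mul_zero],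
      add_zero]
    by_cases hi : i ∈ V.1
    · exact hAw i hi
    · rw [Pi.smul_apply, hw0 i hi, smul_zero]
      refine Finset.sum_eq_zero fun j hj => ?_
      by_contra hne
      exact hi ((isSource_reducedDigraph_iff V).1 hV j hj i
        (lt_of_le_of_ne (hA i j) (Ne.symm (left_ne_zero_of_mul hne))))

end Components

/-! ### Evaluation of the two quotients. -/

section Quotients

variable {ι : Type*} [Fintype ι] [DecidableEq ι] {A : Matrix ι ι ℝ}

theorem cwRatio_one_le {x : ι → ℝ} {t : ℝ} (ht : 0 ≤ t) (h : ∀ i, (A *ᵥ x) i ≤ t * x i) :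
    cwRatio A 1 x ≤ ENNReal.ofReal t :=
  iInf₂_le t.toNNReal fun i => by simpa [Real.coe_toNNReal t ht] using h i

theorem le_cwRatio_one {x : ι → ℝ} {r : ℝ} (h : ∀ t : ℝ, (∀ i, (A *ᵥ x) i ≤ t * x i) → r ≤ t) :
    ENNReal.ofReal r ≤ cwRatio A 1 x := by
  refine le_iInf₂ fun t ht => ?_
  rw [← ENNReal.ofReal_coe_nnreal]
  exact ENNReal.ofReal_le_ofReal (h t (by simpa using ht))

theorem cwQuotient_one_eq [Nonempty ι] (hA : ∀ i j, 0 ≤ A i j) :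
    cwQuotient A 1 = ENNReal.ofReal (specRadius A) := by
  refine le_antisymm ?_ (le_iInf₂ fun x hx =>
    le_cwRatio_one fun t ht => specRadius_le_of_mulVec_le hA hx ht)
  refine ENNReal.le_of_forall_pos_le_add fun ε hε _ => ?_
  obtain ⟨x, hx, hle⟩ := (specRadius_spec hA).2 (specRadius A + ε)
    (lt_add_of_pos_right _ (NNReal.coe_pos.2 hε))
  refine (iInf₂_le x hx).trans ((cwRatio_one_le
    (add_nonneg (specRadius_nonneg A) ε.coe_nonneg) hle).trans_eq ?_)
  rw [ENNReal.ofReal_add (specRadius_nonneg A) ε.coe_nonneg, ENNReal.ofReal_coe_nnreal]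

/-- The weak Collatz-Wielandt quotient is the least spectral radius of a source component. -/
theorem exists_isSource_weakCWQuotient_eq [Nonempty ι] (hA : ∀ i j, 0 ≤ A i j) :
    ∃ V : StrongComponent (matrixDigraph A), IsSource (reducedDigraph (matrixDigraph A)) V ∧
      (∀ W, IsSource (reducedDigraph (matrixDigraph A)) W →
        specRadius (principalSubmatrix A V.1) ≤ specRadius (principalSubmatrix A W.1)) ∧
      weakCWQuotient A 1 = ENNReal.ofReal (specRadius (principalSubmatrix A V.1)) := by
  obtain ⟨V₁, hV₁, -⟩ := exists_isSource_subset (G := matrixDigraph A) Set.univ_nonempty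
    fun _ _ _ _ => Set.mem_univ _
  obtain ⟨V, hV, hmin⟩ := Set.exists_min_image
    {V | IsSource (reducedDigraph (matrixDigraph A)) V}
    (fun V => specRadius (principalSubmatrix A V.1)) (Set.toFinite _) ⟨V₁, hV₁⟩
  refine ⟨V, hV, hmin, le_antisymm ?_ (le_iInf₂ fun x hx => le_cwRatio_one fun t ht => ?_)⟩
  · obtain ⟨w, hw, hw0, hAw⟩ := exists_eigenvector_of_isSource hA hV
    exact (iInf₂_le w ⟨hw, hw0⟩).trans
      (cwRatio_one_le (specRadius_nonneg _) fun i => (congrFun hAw i).le)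
  · obtain ⟨W, hW, hle⟩ := exists_isSource_specRadius_le hA hx.1 hx.2 ht
    exact (hmin W hW).trans hle

end Quotients

/-- An irreducible matrix has exactly one normalized positive vector attaining the
Collatz-Wielandt infimum. -/
theorem existsUnique_isGreatest_of_irreducible {ι : Type*} [Fintype ι] [DecidableEq ι] [Nonempty ι]
    {A : Matrix ι ι ℝ} (hA : ∀ i j, 0 ≤ A i j) (hirr : Irreducible A) :
    ∃! x : ι → ℝ, (∀ i, 0 < x i) ∧ ∑ i, x i = 1 ∧
      IsGreatest (Set.range fun i => (A *ᵥ x) i / x i) (specRadius A) := by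
  obtain ⟨y, hy, hAy⟩ := exists_pos_eigenvector_of_irreducible hA hirr
  have hs : 0 < ∑ i, y i := Finset.sum_pos (fun i _ => hy i) Finset.univ_nonempty
  have hpos : ∀ i, 0 < ((∑ i, y i)⁻¹ • y) i := fun i => mul_pos (inv_pos.2 hs) (hy i)
  refine ⟨(∑ i, y i)⁻¹ • y, ⟨hpos, (smul_inv_sum_mem_stdSimplex (fun i => (hy i).le) hs).2,
    (isGreatest_div_iff hA hpos).2 fun i => ?_⟩, ?_⟩
  · rw [Matrix.mulVec_smul, hAy, smul_comm]
    rfl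
  · rintro x ⟨hx, hx1, hg⟩
    -- The normalization determines the multiple `c` of the Perron vector.
    obtain ⟨c, rfl⟩ := eq_smul_of_irreducible hA hirr ((isGreatest_div_iff hA hx).1 hg) hy hAy
    simp only [Pi.smul_apply, smul_eq_mul, ← Finset.mul_sum] at hx1
    rw [eq_inv_of_mul_eq_one_left hx1]

end CollatzWielandt

open CollatzWielandt

theorem mainTheorem3 {m : ℕ} (hm : 0 < m) (A : Matrix (Fin m) (Fin m) ℝ)
    (hA : ∀ i j, 0 ≤ A i j) :
    -- part 1
    (CollatzWielandt.cwQuotient A 1 = ENNReal.ofReal (CollatzWielandt.specRadius A) ∧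
      ∃ y : Fin m → ℝ, (∀ i, 0 ≤ y i) ∧ y ≠ 0 ∧ A *ᵥ y = CollatzWielandt.specRadius A • y) ∧
    -- part 2
    ((∃ x : Fin m → ℝ, (∀ i, 0 < x i) ∧
        IsGreatest (Set.range fun i => (A *ᵥ x) i / x i) (CollatzWielandt.specRadius A)) ↔
      ∀ V : CollatzWielandt.StrongComponent (CollatzWielandt.matrixDigraph A),
        CollatzWielandt.specRadius (CollatzWielandt.principalSubmatrix A V.1) =
            CollatzWielandt.specRadius A →
          CollatzWielandt.IsSink
            (CollatzWielandt.reducedDigraph (CollatzWielandt.matrixDigraph A)) V) ∧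
    -- part 3
    (CollatzWielandt.Irreducible A →
      ∃! x : Fin m → ℝ, (∀ i, 0 < x i) ∧ ∑ i, x i = 1 ∧
        IsGreatest (Set.range fun i => (A *ᵥ x) i / x i) (CollatzWielandt.specRadius A)) ∧
    -- part 4
    (IsLeast
        {t : ℝ≥0∞ | ∃ V : CollatzWielandt.StrongComponent (CollatzWielandt.matrixDigraph A),
          CollatzWielandt.IsSource
            (CollatzWielandt.reducedDigraph (CollatzWielandt.matrixDigraph A)) V ∧
          t = ENNReal.ofReal
            (CollatzWielandt.specRadius (CollatzWielandt.principalSubmatrix A V.1))}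
        (CollatzWielandt.weakCWQuotient A 1) ∧
      ∃ w : Fin m → ℝ, (∀ i, 0 ≤ w i) ∧ w ≠ 0 ∧
        A *ᵥ w = (CollatzWielandt.weakCWQuotient A 1).toReal • w ∧
        CollatzWielandt.cwRatio A 1 w = CollatzWielandt.weakCWQuotient A 1) := by
  have : Nonempty (Fin m) := ⟨⟨0, hm⟩⟩
  refine ⟨⟨cwQuotient_one_eq hA, (specRadius_spec hA).1⟩, ⟨?_, fun h => ?_⟩,
    existsUnique_isGreatest_of_irreducible hA, ?_⟩
  · rintro ⟨x, hx, hg⟩ V hV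
    exact isSink_of_mulVec_le hA hx V (hV ▸ (isGreatest_div_iff hA hx).1 hg)
  · obtain ⟨x, hx, hle⟩ := exists_pos_mulVec_le_of_isSink hA h
    exact ⟨x, hx, (isGreatest_div_iff hA hx).2 hle⟩
  · obtain ⟨V, hV, hmin, hq⟩ := exists_isSource_weakCWQuotient_eq hA
    obtain ⟨w, hw, hw0, hAw⟩ := exists_eigenvector_of_isSource hA hV
    refine ⟨⟨⟨V, hV, hq⟩, ?_⟩, w, hw, hw0, ?_, le_antisymm ?_ (iInf₂_le w ⟨hw, hw0⟩)⟩
    · rintro _ ⟨W, hW, rfl⟩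
      exact hq.trans_le (ENNReal.ofReal_le_ofReal (hmin W hW))
    · rw [hq, ENNReal.toReal_ofReal (specRadius_nonneg _), hAw]
    · exact (cwRatio_one_le (specRadius_nonneg _) fun i => (congrFun hAw i).le).trans_eq hq.symm
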